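/- There exist universal constants $\beta\ge 1$ and $\gamma_7,\gamma_8,\gamma_9\in(0,+\infty)$ such that the following holds for every $\alpha\in[0,1)$, every $t>0$ and all reals $a_1\ge a_2\ge a_3\ge\dots\ge 0$ with $\sum_{n\ge1}a_n<+\infty$. Let $\kappa_n,\theta_n$, $n=1,2,\dots$, be (jointly) independent random variables such that $\mathbb{P}(\kappa_n=0)=1-\mathbb{P}(\kappa_n=1)=\alpha$ and $\theta_n$ is exponentially distributed with expectation $1$. For $n\ge1$ let $p_n(t)\in\mathbb{R}$ be defined by \[ t=p_n(t)\,a_n+(1-\alpha)\sum_{k>n}a_k \] if $a_n>0$, and let $p_n(t)=+\infty$ if $a_n=0$. Then the series $\sum_{n\ge1}a_n\kappa_n\theta_n$ converges almost surely, \[ \mathbb{P}\Big(\sum_{n\ge 1}a_n\kappa_n\theta_n\ge\gamma_7 t\Big)\le(1-\alpha)\Big\{\sum_{n:\,p_n(t)<2}\alpha^{n-1}+\sum_{n:\,p_n(t)\ge2}\alpha^{n-1}e^{-\beta p_n(t)}\Big\} \] and \[ \mathbb{P}\Big(\sum_{n\ge 1}a_n\kappa_n\theta_n\ge\gamma_8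 t\Big)\ge\gamma_9(1-\alpha)\Big\{\sum_{n:\,p_n(t)<2}\alpha^{n-1}+\sum_{n:\,p_n(t)\ge2}\alpha^{n-1}e^{-\beta p_n(t)}\Big\}, \] where $0^0=1$ and $e^{-\infty}=0$. -/

import Mathlib

open MeasureTheory ProbabilityTheory

noncomputable section

/-- The extended real number `p_n(t)` defined by `t = p_n(t) * a_n + (1 - α) * ∑_{k > n} a_k`
if `a_n > 0`, and `p_n(t) = +∞` otherwise. The sequence is indexed from `0`. -/
def levelExponent (α : ℝ) (a : ℕ → ℝ) (t : ℝ) (n : ℕ) : EReal :=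
  if 0 < a n then (((t - (1 - α) * ∑' k, a (n + 1 + k)) / a n : ℝ) : EReal) else ⊤

/-- For `a_n > 0`, `p_n(t)` is the unique solution of its defining equation. -/
theorem levelExponent_eq_coe_iff (α : ℝ) (a : ℕ → ℝ) (t : ℝ) (n : ℕ) (h : 0 < a n) (r : ℝ) :
    levelExponent α a t n = (r : EReal) ↔ t = r * a n + (1 - α) * ∑' k, a (n + 1 + k) := by
  rw [levelExponent, if_pos h, EReal.coe_eq_coe_iff, div_eq_iff h.ne', sub_eq_iff_eq_add]

/-- The quantity `(1 - α) * (∑_{p_n(t) < 2} α^{n-1} + ∑_{p_n(t) ≥ 2} α^{n-1} exp (-β p_n(t)))`,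
with `exp (-∞) = 0`. As the sequence is indexed from `0`, the weight `α^{n-1}` becomes `α^n`. -/
def tailBound (α : ℝ) (a : ℕ → ℝ) (β t : ℝ) : ENNReal :=
  ENNReal.ofReal (1 - α) *
    ((∑' n : {n : ℕ // levelExponent α a t n < 2}, ENNReal.ofReal (α ^ (n : ℕ))) +
      ∑' n : {n : ℕ // 2 ≤ levelExponent α a t n},
        ENNReal.ofReal (α ^ (n : ℕ)) * EReal.exp (-((β : EReal) * levelExponent α a t n)))

end

/-! Split according to the first index `n` with `κ n = 1`, an event of probability `(1 - α) * α ^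
n`. On it the series is `a n * θ n` plus the later terms, and this remainder (`tailSum`) is
independent of the event. It therefore suffices to compare, for each `n`, the tail of `tailSum` with
the weight `1` (if `p < 2`) or `exp (-p)` (if `p ≥ 2`); this works with `β = 1`.

Upper bound: `a n` is the largest remaining coefficient, so the exponential moment at `l = 1 / (2 *
a n)` is finite and Chernoff gives `exp (-p)` (`measure_tailSum_ge_le`).

Lower bound: either `t` is comparable to the mean `a n + (1 - α) * ∑_{k > n} a k`, which is reached
up to a constant factor with probability at least `1 / 8` (`le_measure_tailSum_ge`), or `p * a n`
dominates `t` and the single event `θ n ≥ p`, of probability `exp (-p)`, suffices. -/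

/-! ### The standard exponential law: exponential moments and tail. -/

lemma ae_nonneg_expMeasure : ∀ᵐ x ∂expMeasure 1, 0 ≤ x := by
  rw [ae_iff, expMeasure, gammaMeasure, withDensity_apply _ (by measurability)]
  have h : {x : ℝ | ¬ 0 ≤ x} = Set.Iio 0 := by ext; simp
  rw [h]
  exact lintegral_exponentialPDF_of_nonpos le_rfl

lemma lintegral_exp_mul_expMeasure {r : ℝ} (hr : r < 1) :
    ∫⁻ x, ENNReal.ofReal (Real.exp (r * x)) ∂expMeasure 1 = ENNReal.ofReal (1 / (1 - r)) := by
  have hpdf : Measurable (gammaPDF 1 1) := (measurable_gammaPDFReal 1 1).ennreal_ofReal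
  have hr' : r - 1 < 0 := by linarith
  rw [expMeasure, gammaMeasure, lintegral_withDensity_eq_lintegral_mul _ hpdf (by fun_prop)]
  have h : (gammaPDF 1 1 * fun x => ENNReal.ofReal (Real.exp (r * x))) =
      (Set.Ici 0).indicator fun x => ENNReal.ofReal (Real.exp ((r - 1) * x)) := by
    ext x
    by_cases hx : 0 ≤ x
    · have := exponentialPDF_of_nonneg (r := 1) hx
      rw [exponentialPDF, exponentialPDFReal] at this
      rw [Pi.mul_apply, gammaPDF, this, Set.indicator_of_mem (by simpa using hx),
        ← ENNReal.ofReal_mul (by positivity), one_mul, ← Real.exp_add]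
      ring_nf
    · rw [Set.indicator_of_notMem (by simpa using hx), Pi.mul_apply,
        gammaPDF_of_neg (not_le.1 hx), zero_mul]
  rw [h, lintegral_indicator measurableSet_Ici, setLIntegral_congr Ioi_ae_eq_Ici.symm,
    ← ofReal_integral_eq_lintegral_ofReal (integrableOn_exp_mul_Ioi hr' 0)
      (ae_of_all _ fun _ => (Real.exp_pos _).le), integral_exp_mul_Ioi hr']
  congr 1
  rw [mul_zero, Real.exp_zero, ← neg_sub 1 r, div_neg, neg_div, neg_neg]

lemma integrable_exp_mul_of_hasLaw_exp {Ω : Type*} [MeasurableSpace Ω] {μ : Measure Ω}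
    {X : Ω → ℝ} (hX : HasLaw X (expMeasure 1) μ) {r : ℝ} (hr : r < 1) :
    Integrable (fun ω => Real.exp (r * X ω)) μ := by
  have h : Integrable (fun x => Real.exp (r * x)) (expMeasure 1) := by
    refine ⟨by fun_prop, ?_⟩
    rw [hasFiniteIntegral_iff_ofReal (ae_of_all _ fun _ => (Real.exp_pos _).le),
      lintegral_exp_mul_expMeasure hr]
    exact ENNReal.ofReal_lt_top
  rw [← hX.map_eq] at h
  exact h.comp_aemeasurable hX.aemeasurable

lemma mgf_of_hasLaw_exp {Ω : Type*} [MeasurableSpace Ω] {μ : Measure Ω}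
    {X : Ω → ℝ} (hX : HasLaw X (expMeasure 1) μ) {r : ℝ} (hr : r < 1) :
    mgf X μ r = 1 / (1 - r) := by
  have h : ∫ x, Real.exp (r * x) ∂expMeasure 1 = 1 / (1 - r) := by
    rw [integral_eq_lintegral_of_nonneg_ae (ae_of_all _ fun _ => (Real.exp_pos _).le)
      (by fun_prop), lintegral_exp_mul_expMeasure hr, ENNReal.toReal_ofReal]
    exact div_nonneg zero_le_one (by linarith)
  rw [← h, ← hX.map_eq, integral_map hX.aemeasurable (by fun_prop), mgf]

lemma measure_ge_of_hasLaw_exp {Ω : Type*} [MeasurableSpace Ω] {μ : Measure Ω}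
    [IsProbabilityMeasure μ] {X : Ω → ℝ} (hX : HasLaw X (expMeasure 1) μ) {x : ℝ} (hx : 0 ≤ x) :
    ENNReal.ofReal (Real.exp (-x)) ≤ μ {ω | x ≤ X ω} := by
  have := isProbabilityMeasure_expMeasure (r := 1) one_pos
  have h1 : (expMeasure 1).real (Set.Iic x)ᶜ = Real.exp (-x) := by
    rw [probReal_compl_eq_one_sub measurableSet_Iic, ← cdf_eq_real, cdf_expMeasure_eq one_pos,
      if_pos hx]
    ring_nf
  rw [← h1, ofReal_measureReal, ← hX.map_eq,
    Measure.map_apply_of_aemeasurable hX.aemeasurable measurableSet_Iic.compl]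
  exact measure_mono fun ω hω => (not_le.1 (show ¬ X ω ≤ x from hω)).le

/-- Functions measurable with respect to disjoint subfamilies of an independent family are
independent. -/
lemma ProbabilityTheory.iIndepFun.indepFun_of_measurable_iSup {Ω ι β γ : Type*}
    {mΩ : MeasurableSpace Ω} [MeasurableSpace β] [MeasurableSpace γ]
    {μ : Measure Ω} {f : ι → Ω → ℝ} (hf : iIndepFun f μ) (hm : ∀ i, Measurable (f i))
    {S T : Set ι} (hST : Disjoint S T) {U : Ω → β} {V : Ω → γ}
    (hU : Measurable[⨆ i ∈ S, MeasurableSpace.comap (f i) inferInstance] U)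
    (hV : Measurable[⨆ i ∈ T, MeasurableSpace.comap (f i) inferInstance] V) :
    IndepFun U V μ := by
  have h := indep_iSup_of_disjoint (fun i => (hm i).comap_le) hf.iIndep hST
  rw [IndepFun_iff_Indep]
  exact indep_of_indep_of_le_left (indep_of_indep_of_le_right h hV.comap_le) hU.comap_le

lemma measurable_iSup_comap {Ω ι : Type*} {f : ι → Ω → ℝ} {S : Set ι} {i : ι} (hi : i ∈ S) :
    Measurable[⨆ i ∈ S, MeasurableSpace.comap (f i) inferInstance] (f i) :=
  Measurable.mono (comap_measurable (f i))
    (le_iSup₂_of_le (f := fun i (_ : i ∈ S) => MeasurableSpace.comap (f i) inferInstance)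
      i hi le_rfl) le_rfl

/-! ### The random family and its decomposition by the first success. -/

/-- `κ n` are Bernoulli variables with `ℙ(κ n = 0) = α`, `θ n` are standard exponential variables,
and all of these are jointly independent. -/
structure IsBernoulliExpFamily {Ω : Type*} [MeasurableSpace Ω] (μ : Measure Ω) (α : ℝ)
    (κ θ : ℕ → Ω → ℝ) : Prop where
  measurable_κ : ∀ n, Measurable (κ n)
  measurable_θ : ∀ n, Measurable (θ n)
  measure_zero : ∀ n, μ.real {ω | κ n ω = 0} = α
  measure_one : ∀ n, μ.real {ω | κ n ω = 1} = 1 - α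
  hasLaw : ∀ n, HasLaw (θ n) (expMeasure 1) μ
  indep : iIndepFun (Sum.elim κ θ) μ

/-- The event that `κ n` is the first variable of the family `κ` that equals one. -/
def firstOne {Ω : Type*} (κ : ℕ → Ω → ℝ) (n : ℕ) : Set Ω :=
  {ω | (∀ i < n, κ i ω = 0) ∧ κ n ω = 1}

/-- A partial sum of `∑ a k * κ k * θ k` over `k ≥ n`, with `κ n` replaced by one. -/
def tailSum {Ω : Type*} (a : ℕ → ℝ) (κ θ : ℕ → Ω → ℝ) (n K : ℕ) (ω : Ω) : ℝ :=
  a n * θ n ω + ∑ k ∈ Finset.range K, a (n + 1 + k) * κ (n + 1 + k) ω * θ (n + 1 + k) ω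

lemma measurable_tailSum {Ω : Type*} {m : MeasurableSpace Ω} (a : ℕ → ℝ) {κ θ : ℕ → Ω → ℝ}
    {n K : ℕ} (hθn : Measurable (θ n)) (hκ : ∀ k < K, Measurable (κ (n + 1 + k)))
    (hθ : ∀ k < K, Measurable (θ (n + 1 + k))) : Measurable (tailSum a κ θ n K) := by
  unfold tailSum
  refine (hθn.const_mul _).add (Finset.measurable_fun_sum _ fun k hk => ?_)
  exact ((hκ k (Finset.mem_range.1 hk)).const_mul _).mul (hθ k (Finset.mem_range.1 hk))

lemma measurableSet_firstOne {Ω : Type*} {m : MeasurableSpace Ω} {κ : ℕ → Ω → ℝ} {n : ℕ}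
    (hκ : ∀ k ≤ n, Measurable (κ k)) : MeasurableSet (firstOne κ n) := by
  have h : firstOne κ n = (⋂ i ∈ Finset.range n, κ i ⁻¹' {0}) ∩ κ n ⁻¹' {1} := by
    ext; simp [firstOne]
  rw [h]
  refine (Finset.measurableSet_biInter _ fun i hi => ?_).inter
    (hκ n le_rfl (measurableSet_singleton _))
  exact hκ i (Finset.mem_range.1 hi).le (measurableSet_singleton _)

lemma measurable_indicator_firstOne {Ω : Type*} {m : MeasurableSpace Ω} {κ : ℕ → Ω → ℝ} {n : ℕ}
    (hκ : ∀ k ≤ n, Measurable (κ k)) : Measurable ((firstOne κ n).indicator (1 : Ω → ℝ)) :=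
  measurable_one.indicator (measurableSet_firstOne hκ)

lemma disjoint_firstOne {Ω : Type*} (κ : ℕ → Ω → ℝ) :
    Pairwise (Function.onFun Disjoint (firstOne κ)) := by
  have key : ∀ i j, i < j → Disjoint (firstOne κ i) (firstOne κ j) := fun i j hij =>
    Set.disjoint_left.2 fun ω hi hj => one_ne_zero (hi.2.symm.trans (hj.1 i hij))
  intro i j hij
  rcases hij.lt_or_gt with h | h
  · exact key i j h
  · exact (key j i h).symm

/-! ### Independence and moment generating functions. -/

namespace IsBernoulliExpFamily

variable {Ω : Type*} [MeasurableSpace Ω] {μ : Measure Ω} {α : ℝ}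
  {κ θ : ℕ → Ω → ℝ}

lemma measurable_elim (h : IsBernoulliExpFamily μ α κ θ) (i : ℕ ⊕ ℕ) :
    Measurable (Sum.elim κ θ i) := by
  cases i
  · exact h.measurable_κ _
  · exact h.measurable_θ _

lemma ae_nonneg (h : IsBernoulliExpFamily μ α κ θ) : ∀ᵐ ω ∂μ, ∀ n, 0 ≤ θ n ω := by
  rw [ae_all_iff]
  intro n
  have := ae_nonneg_expMeasure
  rw [← (h.hasLaw n).map_eq] at this
  exact ae_of_ae_map (h.hasLaw n).aemeasurable this

lemma indepFun_κ_exp (h : IsBernoulliExpFamily μ α κ θ) (n : ℕ) (r : ℝ) :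
    IndepFun (κ n) (fun ω => Real.exp (r * θ n ω) - 1) μ := by
  have hi : IndepFun (κ n) (θ n) μ := h.indep.indepFun (i := Sum.inl n) (j := Sum.inr n) (by simp)
  exact hi.comp (φ := id) (ψ := fun x => Real.exp (r * x) - 1) measurable_id (by fun_prop)

lemma indepFun_tailSum (h : IsBernoulliExpFamily μ α κ θ) (a : ℕ → ℝ) (n K : ℕ) :
    IndepFun (tailSum a κ θ n K)
      (fun ω => a (n + 1 + K) * (κ (n + 1 + K) ω * θ (n + 1 + K) ω)) μ := by
  refine h.indep.indepFun_of_measurable_iSup h.measurable_elim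
    (S := Sum.inr '' Set.Iio (n + 1 + K) ∪ Sum.inl '' Set.Iio (n + 1 + K))
    (T := {Sum.inl (n + 1 + K), Sum.inr (n + 1 + K)}) ?_ ?_ ?_
  · rw [Set.disjoint_left]
    rintro _ (⟨i, hi, rfl⟩ | ⟨i, hi, rfl⟩) hT <;> simp at hi hT <;> omega
  · refine measurable_tailSum a ?_ (fun k hk => ?_) (fun k hk => ?_)
    · exact measurable_iSup_comap (f := Sum.elim κ θ) (i := Sum.inr n) (by simp; omega)
    · exact measurable_iSup_comap (f := Sum.elim κ θ) (i := Sum.inl (n + 1 + k))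
        (by simpa using hk)
    · exact measurable_iSup_comap (f := Sum.elim κ θ) (i := Sum.inr (n + 1 + k))
        (by simpa using hk)
  · refine Measurable.const_mul (Measurable.mul ?_ ?_) _
    · exact measurable_iSup_comap (f := Sum.elim κ θ) (i := Sum.inl (n + 1 + K)) (by simp)
    · exact measurable_iSup_comap (f := Sum.elim κ θ) (i := Sum.inr (n + 1 + K)) (by simp)

variable [IsProbabilityMeasure μ]

lemma ae_zero_or_one (h : IsBernoulliExpFamily μ α κ θ) :
    ∀ᵐ ω ∂μ, ∀ n, κ n ω = 0 ∨ κ n ω = 1 := by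
  rw [ae_all_iff]
  intro n
  have m0 : MeasurableSet {ω | κ n ω = 0} := h.measurable_κ n (measurableSet_singleton 0)
  have m1 : MeasurableSet {ω | κ n ω = 1} := h.measurable_κ n (measurableSet_singleton 1)
  have hd : Disjoint {ω | κ n ω = 0} {ω | κ n ω = 1} :=
    Set.disjoint_left.2 fun ω h0 h1 => zero_ne_one (h0.symm.trans h1)
  have hu := measureReal_union (μ := μ) hd m1
  rw [h.measure_zero, h.measure_one, add_sub_cancel] at hu
  have hc := probReal_compl_eq_one_sub (μ := μ) (m0.union m1)
  rw [hu, sub_self, measureReal_eq_zero_iff] at hc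
  rw [ae_iff]
  convert hc using 2
  ext ω
  simp

lemma integral_κ (h : IsBernoulliExpFamily μ α κ θ) (n : ℕ) : ∫ ω, κ n ω ∂μ = 1 - α := by
  have m1 : MeasurableSet {ω | κ n ω = 1} := h.measurable_κ n (measurableSet_singleton 1)
  rw [← h.measure_one n, ← integral_indicator_one m1]
  refine integral_congr_ae ?_
  filter_upwards [h.ae_zero_or_one] with ω hω
  rcases hω n with h0 | h1
  · simp [h0]
  · simp [h1]

lemma integrable_κ (h : IsBernoulliExpFamily μ α κ θ) (n : ℕ) : Integrable (κ n) μ := by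
  refine Integrable.of_bound (h.measurable_κ n).aestronglyMeasurable 1 ?_
  filter_upwards [h.ae_zero_or_one] with ω hω
  rcases hω n with h0 | h1
  · simp [h0]
  · simp [h1]

/-- As `κ n` takes only the values 0 and 1, the exponential is affine in `κ n`; independence then
factors its expectation. -/
lemma exp_mul_ae_eq (h : IsBernoulliExpFamily μ α κ θ) (n : ℕ) (r : ℝ) :
    (fun ω => Real.exp (r * (κ n ω * θ n ω))) =ᵐ[μ]
      fun ω => 1 + κ n ω * (Real.exp (r * θ n ω) - 1) := by
  filter_upwards [h.ae_zero_or_one] with ω hω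
  rcases hω n with h0 | h1
  · simp [h0]
  · simp [h1]

lemma integrable_exp_mul (h : IsBernoulliExpFamily μ α κ θ) (n : ℕ) {r : ℝ} (hr : r < 1) :
    Integrable (fun ω => Real.exp (r * (κ n ω * θ n ω))) μ := by
  refine Integrable.congr ?_ (h.exp_mul_ae_eq n r).symm
  exact (integrable_const 1).add ((h.indepFun_κ_exp n r).integrable_mul (h.integrable_κ n)
    ((integrable_exp_mul_of_hasLaw_exp (h.hasLaw n) hr).sub (integrable_const 1)))

lemma mgf_mul_le (h : IsBernoulliExpFamily μ α κ θ) (n : ℕ) {r : ℝ} (hr : r < 1) :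
    mgf (fun ω => κ n ω * θ n ω) μ r ≤ Real.exp ((1 - α) * (r / (1 - r))) := by
  have hi := integrable_exp_mul_of_hasLaw_exp (h.hasLaw n) hr
  have hprod : Integrable (fun ω => κ n ω * (Real.exp (r * θ n ω) - 1)) μ := (h.indepFun_κ_exp n r).integrable_mul (h.integrable_κ n)
    (hi.sub (integrable_const 1))
  have hm : ∫ ω, Real.exp (r * θ n ω) ∂μ = 1 / (1 - r) := mgf_of_hasLaw_exp (h.hasLaw n) hr
  have hval : mgf (fun ω => κ n ω * θ n ω) μ r = 1 + (1 - α) * (r / (1 - r)) := by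
    rw [mgf, integral_congr_ae (h.exp_mul_ae_eq n r), integral_add (integrable_const 1) hprod,
      (h.indepFun_κ_exp n r).integral_fun_mul_eq_mul_integral
        (h.measurable_κ n).aestronglyMeasurable (hi.sub (integrable_const 1)).aestronglyMeasurable,
      h.integral_κ, integral_sub hi (integrable_const 1), hm]
    have : 1 - r ≠ 0 := by linarith
    simp
    field_simp
    simp
  rw [hval, add_comm]
  exact Real.add_one_le_exp _

lemma measure_firstOne (h : IsBernoulliExpFamily μ α κ θ) (hα : 0 ≤ α) (n : ℕ) :
    μ (firstOne κ n) = ENNReal.ofReal (1 - α) * ENNReal.ofReal (α ^ n) := by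
  have hκ : iIndepFun κ μ := iIndepFun.precomp (f := Sum.elim κ θ) (g := Sum.inl) Sum.inl_injective h.indep
  have := hκ.measure_inter_preimage_eq_mul (Finset.range (n + 1))
    (sets := fun i => if i < n then {0} else {1})
    (fun i _ => by split_ifs <;> exact measurableSet_singleton _)
  have hs : (⋂ i ∈ Finset.range (n + 1), κ i ⁻¹' if i < n then {0} else {1}) = firstOne κ n := by
    ext ω
    simp only [Set.mem_iInter, Finset.mem_range, firstOne, Set.mem_ofPred_eq, Set.mem_preimage]
    constructor
    · intro H
      refine ⟨fun i hi => ?_, ?_⟩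
      · simpa [hi] using H i (by omega)
      · simpa using H n (by omega)
    · rintro ⟨H0, H1⟩ i hi
      split_ifs with hin
      · exact H0 i hin
      · obtain rfl : i = n := by omega
        exact H1
  have m0 : ∀ i, μ (κ i ⁻¹' {0}) = ENNReal.ofReal α := fun i => by
    rw [← h.measure_zero i, ofReal_measureReal]; rfl
  have m1 : ∀ i, μ (κ i ⁻¹' {1}) = ENNReal.ofReal (1 - α) := fun i => by
    rw [← h.measure_one i, ofReal_measureReal]; rfl
  rw [hs, Finset.prod_range_succ, Finset.prod_congr rfl (g := fun _ => ENNReal.ofReal α)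
    (fun i hi => by rw [if_pos (Finset.mem_range.1 hi), m0])] at this
  rw [this, if_neg (lt_irrefl n), m1, Finset.prod_const, Finset.card_range,
    ENNReal.ofReal_pow hα, mul_comm]

/-- The event involves `κ i` for `i ≤ n` only. Having `κ n` replaced by one, `tailSum` involves only
`κ i` with `i > n` and `θ i` with `i ≥ n`, a disjoint set of variables. -/
lemma measure_firstOne_inter (h : IsBernoulliExpFamily μ α κ θ) (hα : 0 ≤ α) (a : ℕ → ℝ)
    (n K : ℕ) {s : Set ℝ} (hs : MeasurableSet s) :
    μ (firstOne κ n ∩ tailSum a κ θ n K ⁻¹' s) =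
      ENNReal.ofReal (1 - α) * ENNReal.ofReal (α ^ n) * μ (tailSum a κ θ n K ⁻¹' s) := by
  have hi : IndepFun ((firstOne κ n).indicator (1 : Ω → ℝ)) (tailSum a κ θ n K) μ := by
    refine h.indep.indepFun_of_measurable_iSup h.measurable_elim
      (S := Sum.inl '' Set.Iic n) (T := Sum.inr '' Set.Ici n ∪ Sum.inl '' Set.Ioi n) ?_ ?_ ?_
    · rw [Set.disjoint_left]
      rintro _ ⟨i, hi, rfl⟩ hT
      simp only [Set.mem_Iic] at hi
      simp at hT
      omega
    · refine measurable_indicator_firstOne fun k hk => ?_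
      exact measurable_iSup_comap (f := Sum.elim κ θ) (i := Sum.inl k) (by simpa using hk)
    · refine measurable_tailSum a ?_ (fun k _ => ?_) (fun k _ => ?_)
      · exact measurable_iSup_comap (f := Sum.elim κ θ) (i := Sum.inr n) (by simp)
      · exact measurable_iSup_comap (f := Sum.elim κ θ) (i := Sum.inl (n + 1 + k))
          (by simp; omega)
      · exact measurable_iSup_comap (f := Sum.elim κ θ) (i := Sum.inr (n + 1 + k))
          (by simp; omega)
  have := hi.measure_inter_preimage_eq_mul {1} s (measurableSet_singleton _) hs
  have hpre : (firstOne κ n).indicator (1 : Ω → ℝ) ⁻¹' {1} = firstOne κ n := by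
    ext ω
    by_cases hω : ω ∈ firstOne κ n <;> simp [hω]
  rwa [hpre, h.measure_firstOne hα] at this

/-- Adding one independent term at a time multiplies the generating functions. The sign of `l` is
free: a positive `l` serves the upper tail, a negative one the lower tail. -/
lemma mgf_tailSum_le (h : IsBernoulliExpFamily μ α κ θ) {a : ℕ → ℝ} {n : ℕ} {l : ℝ}
    (hl : ∀ k, n ≤ k → l * a k < 1) (K : ℕ) :
    Integrable (fun ω => Real.exp (l * tailSum a κ θ n K ω)) μ ∧
      mgf (tailSum a κ θ n K) μ l ≤ 1 / (1 - l * a n) * Real.exp ((1 - α) *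
        ∑ k ∈ Finset.range K, l * a (n + 1 + k) / (1 - l * a (n + 1 + k))) := by
  induction K with
  | zero =>
    have e : tailSum a κ θ n 0 = fun ω => a n * θ n ω := by ext; simp [tailSum]
    rw [e, mgf_const_mul]
    refine ⟨?_, ?_⟩
    · simpa only [mul_assoc] using integrable_exp_mul_of_hasLaw_exp (h.hasLaw n) (hl n le_rfl)
    · rw [mul_comm (a n) l]
      simp [mgf_of_hasLaw_exp (h.hasLaw n) (hl n le_rfl)]
  | succ K ih =>
    have e : tailSum a κ θ n (K + 1) = tailSum a κ θ n K +
        fun ω => a (n + 1 + K) * (κ (n + 1 + K) ω * θ (n + 1 + K) ω) := by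
      ext ω
      simp only [tailSum, Finset.sum_range_succ, Pi.add_apply]
      ring
    have hlk := hl (n + 1 + K) (by omega)
    have hI := h.integrable_exp_mul (n + 1 + K) hlk
    simp only [mul_assoc] at hI
    have hint := (h.indepFun_tailSum a n K).integrable_exp_mul_add ih.1 hI
    refine ⟨by rwa [e], ?_⟩
    rw [e, (h.indepFun_tailSum a n K).mgf_add ih.1.aestronglyMeasurable hI.aestronglyMeasurable,
      mgf_const_mul, Finset.sum_range_succ, mul_add (1 - α), Real.exp_add, ← mul_assoc]
    have := h.mgf_mul_le (n + 1 + K) hlk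
    rw [mul_comm (a (n + 1 + K)) l]
    refine mul_le_mul ih.2 this mgf_nonneg ?_
    have := hl n le_rfl
    exact mul_nonneg (div_nonneg zero_le_one (by linarith)) (Real.exp_pos _).le

end IsBernoulliExpFamily

/-! ### Chernoff bounds for the remainder, and almost sure convergence. -/

namespace IsBernoulliExpFamily

variable {Ω : Type*} [MeasurableSpace Ω] {μ : Measure Ω} [IsProbabilityMeasure μ] {α : ℝ}
  {κ θ : ℕ → Ω → ℝ}

lemma measure_tailSum_ge_le (h : IsBernoulliExpFamily μ α κ θ) (hα : α < 1)
    {a : ℕ → ℝ} (ha : ∀ n, 0 ≤ a n) (hanti : Antitone a) (hsum : Summable a) {n : ℕ}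
    (hn : 0 < a n) {p t : ℝ} (hp : 2 ≤ p)
    (ht : t = p * a n + (1 - α) * ∑' k, a (n + 1 + k)) (K : ℕ) :
    μ {ω | 4 * t ≤ tailSum a κ θ n K ω} ≤ ENNReal.ofReal (Real.exp (-p)) := by
  -- With this `l`, every `x = l * a k`, `k ≥ n`, is at most `1 / 2`, so `x / (1 - x) ≤ 2 * x`, and
  -- the factor from `θ n` is `2 ≤ exp p`.
  set l : ℝ := 1 / (2 * a n) with hl
  have hl0 : 0 < l := by positivity
  have hln : l * a n = 1 / 2 := by rw [hl]; field_simp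
  have hlk : ∀ k, n ≤ k → l * a k ≤ 1 / 2 := fun k hk => by
    rw [← hln]; exact mul_le_mul_of_nonneg_left (hanti hk) hl0.le
  obtain ⟨hint, hmgf⟩ := h.mgf_tailSum_le (a := a) (n := n) (l := l)
    (fun k hk => (hlk k hk).trans_lt (by norm_num)) K
  have hch := measure_ge_le_exp_mul_mgf (4 * t) hl0.le hint
  rw [← ofReal_measureReal]
  refine ENNReal.ofReal_le_ofReal (hch.trans ?_)
  have htail : ∑ k ∈ Finset.range K, a (n + 1 + k) ≤ ∑' k, a (n + 1 + k) :=
    (hsum.comp_injective (add_right_injective (n + 1))).sum_le_tsum _ fun k _ => ha _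
  have hterm : ∑ k ∈ Finset.range K, l * a (n + 1 + k) / (1 - l * a (n + 1 + k)) ≤
      2 * l * ∑' k, a (n + 1 + k) := by
    refine le_trans ?_ (mul_le_mul_of_nonneg_left htail (by positivity))
    rw [Finset.mul_sum]
    refine Finset.sum_le_sum fun k _ => ?_
    have h1 := hlk (n + 1 + k) (by omega)
    have h0 : 0 ≤ l * a (n + 1 + k) := mul_nonneg hl0.le (ha _)
    rw [div_le_iff₀ (by linarith)]
    nlinarith
  have htsum : 0 ≤ ∑' k, a (n + 1 + k) := tsum_nonneg fun k => ha _
  have hexp : (1 - α) * ∑ k ∈ Finset.range K, l * a (n + 1 + k) / (1 - l * a (n + 1 + k)) ≤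
      (1 - α) * (2 * l * ∑' k, a (n + 1 + k)) :=
    mul_le_mul_of_nonneg_left hterm (by linarith)
  have h2 : (2 : ℝ) ≤ Real.exp p := by linarith [Real.add_one_le_exp p]
  calc Real.exp (-l * (4 * t)) * mgf (tailSum a κ θ n K) μ l
      ≤ Real.exp (-l * (4 * t)) *
          (Real.exp p * Real.exp ((1 - α) * (2 * l * ∑' k, a (n + 1 + k)))) := by
        refine mul_le_mul_of_nonneg_left (hmgf.trans ?_) (Real.exp_pos _).le
        rw [hln]
        exact mul_le_mul (by norm_num; exact h2) (Real.exp_le_exp.2 hexp) (Real.exp_pos _).le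
          (Real.exp_pos _).le
    _ = Real.exp (-l * (4 * t) + (p + (1 - α) * (2 * l * ∑' k, a (n + 1 + k)))) := by
        rw [Real.exp_add, Real.exp_add]
    _ ≤ Real.exp (-p) := by
        -- Since `l * t = p / 2 + l * (1 - α) * ∑' k, a (n + 1 + k)`, the factor 4 leaves the
        -- exponent `-p` minus a nonnegative term.
        refine Real.exp_le_exp.2 ?_
        have : 0 ≤ l * ((1 - α) * ∑' k, a (n + 1 + k)) :=
          mul_nonneg hl0.le (mul_nonneg (by linarith) htsum)
        rw [ht]
        linear_combination (-4 * p) * hln + 2 * this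

lemma le_measure_tailSum_ge (h : IsBernoulliExpFamily μ α κ θ) (hα : α < 1)
    {a : ℕ → ℝ} (ha : ∀ n, 0 ≤ a n) (hanti : Antitone a) {n : ℕ} (hn : 0 < a n) (K : ℕ) :
    ENNReal.ofReal (1 / 8) ≤
      μ {ω | (a n + (1 - α) * ∑ k ∈ Finset.range K, a (n + 1 + k)) / 2 ≤
        tailSum a κ θ n K ω} := by
  set m := ∑ k ∈ Finset.range K, a (n + 1 + k) with hm
  -- Chernoff at `-l`: `x = l * a k` lies in `[0, 1]`, so `-x / (1 + x) ≤ -x / 2`. The contributions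
  -- of the later terms cancel, leaving `exp (1 / 2) / 2 ≤ 7 / 8` for the complementary event.
  set l : ℝ := 1 / a n with hl
  have hl0 : 0 < l := by positivity
  have hln : l * a n = 1 := by rw [hl]; field_simp
  have hlk : ∀ k, n ≤ k → l * a k ≤ 1 := fun k hk => by
    rw [← hln]; exact mul_le_mul_of_nonneg_left (hanti hk) hl0.le
  have hlk0 : ∀ k, 0 ≤ l * a k := fun k => mul_nonneg hl0.le (ha k)
  obtain ⟨hint, hmgf⟩ := h.mgf_tailSum_le (a := a) (n := n) (l := -l)
    (fun k hk => by linarith [hlk0 k]) K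
  have hch := measure_le_le_exp_mul_mgf ((a n + (1 - α) * m) / 2) (neg_nonpos.2 hl0.le) hint
  have hterm : ∑ k ∈ Finset.range K, -l * a (n + 1 + k) / (1 - -l * a (n + 1 + k)) ≤
      -(l / 2) * m := by
    rw [hm, Finset.mul_sum]
    refine Finset.sum_le_sum fun k _ => ?_
    have h1 := hlk (n + 1 + k) (by omega)
    have h0 := hlk0 (n + 1 + k)
    rw [div_le_iff₀ (by linarith)]
    nlinarith
  have hexp := mul_le_mul_of_nonneg_left hterm (sub_nonneg.2 hα.le)
  have he : Real.exp (1 / 2) ≤ 7 / 4 := by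
    have h1 : Real.exp (1 / 2) * Real.exp (1 / 2) = Real.exp 1 := by
      rw [← Real.exp_add]; norm_num
    nlinarith [Real.exp_one_lt_d9, Real.exp_pos (1 / 2)]
  have hupper : μ.real {ω | tailSum a κ θ n K ω ≤ (a n + (1 - α) * m) / 2} ≤ 7 / 8 := by
    calc _ ≤ _ := hch
      _ ≤ Real.exp (- -l * ((a n + (1 - α) * m) / 2)) *
            (1 / 2 * Real.exp ((1 - α) * (-(l / 2) * m))) := by
          refine mul_le_mul_of_nonneg_left (hmgf.trans ?_) (Real.exp_pos _).le
          have : 1 - -l * a n = 2 := by linarith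
          rw [this]
          exact mul_le_mul_of_nonneg_left (Real.exp_le_exp.2 hexp) (by norm_num)
      _ = 1 / 2 * Real.exp (- -l * ((a n + (1 - α) * m) / 2) + (1 - α) * (-(l / 2) * m)) := by
          rw [Real.exp_add]; ring
      _ = 1 / 2 * Real.exp (1 / 2) := by
          congr 2
          linear_combination (1 / 2) * hln
      _ ≤ 7 / 8 := by linarith
  have hms : MeasurableSet {ω | tailSum a κ θ n K ω ≤ (a n + (1 - α) * m) / 2} :=
    measurableSet_le (measurable_tailSum a (h.measurable_θ n) (fun _ _ => h.measurable_κ _)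
      fun _ _ => h.measurable_θ _) measurable_const
  have hcompl := probReal_compl_eq_one_sub (μ := μ) hms
  calc ENNReal.ofReal (1 / 8)
      ≤ ENNReal.ofReal (μ.real {ω | tailSum a κ θ n K ω ≤ (a n + (1 - α) * m) / 2}ᶜ) :=
        ENNReal.ofReal_le_ofReal (by rw [hcompl]; linarith)
    _ = _ := ofReal_measureReal
    _ ≤ _ := measure_mono fun ω hω => (not_le.1 (Set.notMem_ofPred_iff.1 hω)).le

/-- Since `x ≤ 2 * exp (x / 2)` and `exp (θ n / 2)` has mean 2, the series is dominated by one with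
finite expectation. -/
lemma ae_summable (h : IsBernoulliExpFamily μ α κ θ)
    {a : ℕ → ℝ} (ha : ∀ n, 0 ≤ a n) (hsum : Summable a) :
    ∀ᵐ ω ∂μ, Summable fun n => a n * κ n ω * θ n ω := by
  have hmeas : ∀ n, AEMeasurable
      (fun ω => ENNReal.ofReal (a n) * ENNReal.ofReal (Real.exp (1 / 2 * θ n ω))) μ := fun n =>
    (((h.measurable_θ n).const_mul _).exp.ennreal_ofReal.const_mul _).aemeasurable
  have hθ : ∀ n, ∫⁻ ω, ENNReal.ofReal (Real.exp (1 / 2 * θ n ω)) ∂μ = 2 := fun n => by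
    have := lintegral_exp_mul_expMeasure (r := 1 / 2) (by norm_num)
    rw [← (h.hasLaw n).map_eq, lintegral_map (by fun_prop) (h.measurable_θ n)] at this
    rw [this]
    norm_num
  have hfin : ∫⁻ ω, ∑' n, ENNReal.ofReal (a n) * ENNReal.ofReal (Real.exp (1 / 2 * θ n ω)) ∂μ
      ≠ ⊤ := by
    rw [lintegral_tsum hmeas]
    have : ∀ n, ∫⁻ ω, ENNReal.ofReal (a n) * ENNReal.ofReal (Real.exp (1 / 2 * θ n ω)) ∂μ =
        ENNReal.ofReal (a n) * 2 := fun n => by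
      rw [lintegral_const_mul _ ((h.measurable_θ n).const_mul _).exp.ennreal_ofReal, hθ]
    simp_rw [this]
    rw [ENNReal.tsum_mul_right]
    exact ENNReal.mul_ne_top hsum.tsum_ofReal_ne_top (by norm_num)
  filter_upwards [ae_lt_top' (AEMeasurable.tsum hmeas) hfin, h.ae_nonneg,
    h.ae_zero_or_one] with ω hω hθ0 hκ
  have hs : Summable fun n => a n * Real.exp (1 / 2 * θ n ω) := by
    have := ENNReal.summable_toReal hω.ne
    refine this.congr fun n => ?_
    rw [ENNReal.toReal_mul, ENNReal.toReal_ofReal (ha n), ENNReal.toReal_ofReal (Real.exp_pos _).le]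
  refine Summable.of_nonneg_of_le (fun n => ?_) (fun n => ?_) (hs.mul_left 2)
  · rcases hκ n with h0 | h1
    · simp [h0]
    · rw [h1, mul_one]
      exact mul_nonneg (ha n) (hθ0 n)
  · have he := Real.add_one_le_exp (1 / 2 * θ n ω)
    have hpos : θ n ω ≤ 2 * Real.exp (1 / 2 * θ n ω) := by linarith
    rcases hκ n with h0 | h1
    · simp only [h0, mul_zero, zero_mul]
      exact mul_nonneg zero_le_two (mul_nonneg (ha n) (Real.exp_pos _).le)
    · rw [h1, mul_one]
      calc a n * θ n ω ≤ a n * (2 * Real.exp (1 / 2 * θ n ω)) :=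
            mul_le_mul_of_nonneg_left hpos (ha n)
        _ = _ := by ring

end IsBernoulliExpFamily

/-! ### Comparison with the weights, and summation over the first success. -/

/-- The weight of the index `n` in `tailBound`. -/
noncomputable def levelWeight (α : ℝ) (a : ℕ → ℝ) (β t : ℝ) (n : ℕ) : ENNReal :=
  if levelExponent α a t n < 2 then 1 else EReal.exp (-((β : EReal) * levelExponent α a t n))

lemma tailBound_eq_tsum (α : ℝ) (a : ℕ → ℝ) (β t : ℝ) :
    tailBound α a β t =
      ∑' n, ENNReal.ofReal (1 - α) * ENNReal.ofReal (α ^ n) * levelWeight α a β t n := by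
  simp_rw [mul_assoc]
  rw [ENNReal.tsum_mul_left, tailBound]
  congr 1
  refine (congrArg₂ (· + ·)
    (tsum_subtype {n | levelExponent α a t n < 2} fun n => ENNReal.ofReal (α ^ n))
    (tsum_subtype {n | 2 ≤ levelExponent α a t n} fun n => ENNReal.ofReal (α ^ n) *
      EReal.exp (-((β : EReal) * levelExponent α a t n)))).trans ?_
  rw [← ENNReal.tsum_add]
  refine tsum_congr fun n => ?_
  by_cases hn : levelExponent α a t n < 2
  · simp [levelWeight, Set.indicator, hn, not_le.2 hn]
  · simp [levelWeight, Set.indicator, hn, not_lt.1 hn]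

lemma levelWeight_of_lt {α : ℝ} {a : ℕ → ℝ} {t : ℝ} {n : ℕ} (β : ℝ) (hn : 0 < a n) {p : ℝ}
    (hp : p < 2) (ht : t = p * a n + (1 - α) * ∑' k, a (n + 1 + k)) :
    levelWeight α a β t n = 1 := by
  rw [levelWeight, (levelExponent_eq_coe_iff α a t n hn p).2 ht, if_pos]
  exact EReal.coe_lt_coe_iff.2 hp

lemma levelWeight_of_ge {α : ℝ} {a : ℕ → ℝ} {t : ℝ} {n : ℕ} (β : ℝ) (hn : 0 < a n) {p : ℝ}
    (hp : 2 ≤ p) (ht : t = p * a n + (1 - α) * ∑' k, a (n + 1 + k)) :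
    levelWeight α a β t n = ENNReal.ofReal (Real.exp (-(β * p))) := by
  rw [levelWeight, (levelExponent_eq_coe_iff α a t n hn p).2 ht, if_neg, ← EReal.exp_coe]
  · norm_cast
  · rw [not_lt]
    exact EReal.coe_le_coe_iff.2 hp

lemma levelWeight_of_eq_zero {α : ℝ} {a : ℕ → ℝ} {t : ℝ} {n : ℕ} {β : ℝ} (hβ : 0 < β)
    (hn : a n = 0) : levelWeight α a β t n = 0 := by
  rw [levelWeight, levelExponent, if_neg hn.le.not_gt, if_neg (by simp),
    EReal.coe_mul_top_of_pos hβ]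
  simp

lemma sum_range_eq_tailSum {Ω : Type*} (a : ℕ → ℝ) {κ θ : ℕ → Ω → ℝ} {n : ℕ} {ω : Ω}
    (hω : ω ∈ firstOne κ n) (K : ℕ) :
    ∑ k ∈ Finset.range (n + 1 + K), a k * κ k ω * θ k ω = tailSum a κ θ n K ω := by
  rw [Finset.sum_range_add, Finset.sum_range_succ, hω.2, mul_one, Finset.sum_eq_zero, zero_add]
  · rfl
  · intro k hk
    rw [hω.1 k (Finset.mem_range.1 hk), mul_zero, zero_mul]

lemma tailSum_eq_zero {Ω : Type*} {a : ℕ → ℝ} (ha : ∀ n, 0 ≤ a n) (hanti : Antitone a)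
    (κ θ : ℕ → Ω → ℝ) {n : ℕ} (hn : a n = 0) (K : ℕ) (ω : Ω) : tailSum a κ θ n K ω = 0 := by
  have hz : ∀ k, n ≤ k → a k = 0 := fun k hk => le_antisymm (hn ▸ hanti hk) (ha k)
  rw [tailSum, hn, zero_mul, zero_add]
  refine Finset.sum_eq_zero fun k _ => ?_
  rw [hz _ (by omega), zero_mul, zero_mul]

namespace IsBernoulliExpFamily

variable {Ω : Type*} [MeasurableSpace Ω] {μ : Measure Ω} [IsProbabilityMeasure μ] {α : ℝ}
  {κ θ : ℕ → Ω → ℝ}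

lemma ae_nonneg_term (h : IsBernoulliExpFamily μ α κ θ) {a : ℕ → ℝ} (ha : ∀ n, 0 ≤ a n) :
    ∀ᵐ ω ∂μ, ∀ n, 0 ≤ a n * κ n ω * θ n ω := by
  filter_upwards [h.ae_nonneg, h.ae_zero_or_one] with ω hθ hκ n
  refine mul_nonneg (mul_nonneg (ha n) ?_) (hθ n)
  rcases hκ n with h0 | h1
  · exact h0.ge
  · exact h1 ▸ zero_le_one

lemma measure_tailSum_ge_le_levelWeight (h : IsBernoulliExpFamily μ α κ θ) (hα : α < 1)
    {a : ℕ → ℝ} (ha : ∀ n, 0 ≤ a n) (hanti : Antitone a) (hsum : Summable a) {t : ℝ}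
    (ht : 0 < t) (n K : ℕ) :
    μ {ω | 4 * t ≤ tailSum a κ θ n K ω} ≤ levelWeight α a 1 t n := by
  rcases (ha n).eq_or_lt with hn | hn
  · have hempty : {ω | 4 * t ≤ tailSum a κ θ n K ω} = ∅ := by
      ext ω
      simp [tailSum_eq_zero ha hanti κ θ hn.symm, ht]
    rw [hempty, measure_empty]
    exact zero_le
  · have hp := (levelExponent_eq_coe_iff α a t n hn _).1 (by rw [levelExponent, if_pos hn])
    rcases lt_or_ge ((t - (1 - α) * ∑' k, a (n + 1 + k)) / a n) 2 with h2 | h2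
    · rw [levelWeight_of_lt 1 hn h2 hp]
      exact prob_le_one
    · rw [levelWeight_of_ge 1 hn h2 hp, one_mul]
      exact h.measure_tailSum_ge_le hα ha hanti hsum hn h2 hp K

lemma exists_le_measure_tailSum (h : IsBernoulliExpFamily μ α κ θ) (hα : α < 1)
    {a : ℕ → ℝ} (ha : ∀ n, 0 ≤ a n) (hanti : Antitone a) (hsum : Summable a) {t : ℝ}
    (ht : 0 < t) (n : ℕ) :
    ∃ K, ENNReal.ofReal (1 / 8) * levelWeight α a 1 t n ≤
      μ {ω | 1 / 8 * t ≤ tailSum a κ θ n K ω} := by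
  rcases (ha n).eq_or_lt with hn | hn
  · exact ⟨0, by simp [levelWeight_of_eq_zero one_pos hn.symm]⟩
  have hp := (levelExponent_eq_coe_iff α a t n hn _).1 (by rw [levelExponent, if_pos hn])
  set p := (t - (1 - α) * ∑' k, a (n + 1 + k)) / a n
  set m := ∑' k, a (n + 1 + k) with hm
  have hm0 : 0 ≤ m := tsum_nonneg fun k => ha _
  have hq : 0 < 1 - α := by linarith
  have hqm : 0 ≤ (1 - α) * m := mul_nonneg hq.le hm0
  -- Truncating at half of `m` costs a factor 2, the Chernoff bound another 2 and this hypothesis a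
  -- third, hence `1 / 8`.
  have bulk : t ≤ 2 * (a n + (1 - α) * m) →
      ∃ K, ENNReal.ofReal (1 / 8) ≤ μ {ω | 1 / 8 * t ≤ tailSum a κ θ n K ω} := by
    intro hbound
    obtain ⟨K, hK⟩ : ∃ K, m / 2 ≤ ∑ k ∈ Finset.range K, a (n + 1 + k) := by
      rcases hm0.eq_or_lt with h0 | h0
      · exact ⟨0, by simp [← h0]⟩
      · have hs : Summable fun k => a (n + 1 + k) :=
          hsum.comp_injective (add_right_injective (n + 1))
        have := hs.hasSum.tendsto_sum_nat.eventually (lt_mem_nhds (half_lt_self h0))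
        obtain ⟨K, hK⟩ := this.exists
        exact ⟨K, hK.le⟩
    refine ⟨K, (h.le_measure_tailSum_ge hα ha hanti hn K).trans (measure_mono fun ω hω => ?_)⟩
    have := mul_le_mul_of_nonneg_left hK hq.le
    rw [Set.mem_ofPred_eq] at hω ⊢
    linarith
  rcases lt_or_ge p 2 with h2 | h2
  · rw [levelWeight_of_lt 1 hn h2 hp, mul_one]
    exact bulk (by nlinarith)
  · rw [levelWeight_of_ge 1 hn h2 hp, one_mul]
    rcases le_or_gt (p * a n) ((1 - α) * m) with hc | hc
    · obtain ⟨K, hK⟩ := bulk (by linarith)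
      refine ⟨K, le_trans (mul_le_of_le_one_right zero_le ?_) hK⟩
      rw [ENNReal.ofReal_le_one, Real.exp_le_one_iff]
      linarith
    -- Here `t < 2 * p * a n`, so `θ n ≥ p` alone makes the first term exceed `t / 2`; no later term
    -- is needed.
    · refine ⟨0, ?_⟩
      calc ENNReal.ofReal (1 / 8) * ENNReal.ofReal (Real.exp (-p))
          ≤ ENNReal.ofReal (Real.exp (-p)) :=
            mul_le_of_le_one_left zero_le (by rw [ENNReal.ofReal_le_one]; norm_num)
        _ ≤ μ {ω | p ≤ θ n ω} := measure_ge_of_hasLaw_exp (h.hasLaw n) (by linarith)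
        _ ≤ _ := measure_mono fun ω hω => by
            have h1 := mul_le_mul_of_nonneg_right (show p ≤ θ n ω from hω) hn.le
            have h3 : 0 < p * a n := by positivity
            simp only [tailSum, Finset.range_zero, Finset.sum_empty, add_zero, Set.mem_ofPred_eq]
            linarith

theorem measure_tsum_ge_le_tailBound (h : IsBernoulliExpFamily μ α κ θ) (hα0 : 0 ≤ α)
    (hα : α < 1) {a : ℕ → ℝ} (ha : ∀ n, 0 ≤ a n) (hanti : Antitone a) (hsum : Summable a)
    {t : ℝ} (ht : 0 < t) :
    μ {ω | 5 * t ≤ ∑' n, a n * κ n ω * θ n ω} ≤ tailBound α a 1 t := by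
  set B : ℕ → ℕ → Set Ω := fun n K => firstOne κ n ∩ tailSum a κ θ n K ⁻¹' Set.Ici (4 * t)
    with hB
  have hBle : ∀ n, μ (⋃ K, ⋂ j ∈ Set.Ici K, B n j) ≤
      ENNReal.ofReal (1 - α) * ENNReal.ofReal (α ^ n) * levelWeight α a 1 t n := fun n => by
    -- The events "`B n j` for all `j ≥ K`" increase with `K`, so the bound for finite truncations,
    -- uniform in `K`, passes to their union.
    have hmono : Monotone fun K => ⋂ j ∈ Set.Ici K, B n j := fun K L hKL =>
      Set.biInter_subset_biInter_left (Set.Ici_subset_Ici.2 hKL)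
    rw [hmono.measure_iUnion]
    refine iSup_le fun K => (measure_mono (Set.biInter_subset_of_mem Set.self_mem_Ici)).trans ?_
    rw [hB, h.measure_firstOne_inter hα0 a n K measurableSet_Ici]
    gcongr
    exact h.measure_tailSum_ge_le_levelWeight hα ha hanti hsum ht n K
  calc μ {ω | 5 * t ≤ ∑' n, a n * κ n ω * θ n ω}
      ≤ μ (⋃ n, ⋃ K, ⋂ j ∈ Set.Ici K, B n j) := by
        refine measure_mono_ae ?_
        filter_upwards [h.ae_summable ha hsum, h.ae_zero_or_one] with ω hs hκ hω
        replace hω : 5 * t ≤ ∑' n, a n * κ n ω * θ n ω := hω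
        -- If no `κ n` were one, the series would vanish and could not reach `5 * t > 0`.
        have hex : ∃ n, κ n ω = 1 := by
          by_contra! hne
          have : ∀ n, κ n ω = 0 := fun n => (hκ n).resolve_right (hne n)
          simp only [this, mul_zero, zero_mul, tsum_zero] at hω
          linarith
        classical
        have hfirst : ω ∈ firstOne κ (Nat.find hex) :=
          ⟨fun i hi => (hκ i).resolve_right (Nat.find_min hex hi), Nat.find_spec hex⟩
        -- The gap between `5 * t` and `4 * t` puts all sufficiently long partial sums above `4 *
        -- t`.
        have hev := hs.hasSum.tendsto_sum_nat.eventually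
          (lt_mem_nhds (show 4 * t < _ by linarith))
        obtain ⟨K, hK⟩ := Filter.eventually_atTop.1 hev
        refine Set.mem_iUnion.2 ⟨Nat.find hex, Set.mem_iUnion.2 ⟨K, Set.mem_iInter₂.2
          fun j hj => ⟨hfirst, ?_⟩⟩⟩
        rw [Set.mem_preimage, ← sum_range_eq_tailSum a hfirst]
        exact (hK _ (le_add_left (Set.mem_Ici.1 hj))).le
    _ ≤ ∑' n, μ (⋃ K, ⋂ j ∈ Set.Ici K, B n j) := measure_iUnion_le _
    _ ≤ tailBound α a 1 t := by
        rw [tailBound_eq_tsum]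
        exact ENNReal.tsum_le_tsum hBle

theorem tailBound_le_measure_tsum_ge (h : IsBernoulliExpFamily μ α κ θ) (hα0 : 0 ≤ α)
    (hα : α < 1) {a : ℕ → ℝ} (ha : ∀ n, 0 ≤ a n) (hanti : Antitone a) (hsum : Summable a)
    {t : ℝ} (ht : 0 < t) :
    ENNReal.ofReal (1 / 8) * tailBound α a 1 t ≤
      μ {ω | 1 / 8 * t ≤ ∑' n, a n * κ n ω * θ n ω} := by
  choose K hK using h.exists_le_measure_tailSum hα ha hanti hsum ht
  set B : ℕ → Set Ω := fun n => firstOne κ n ∩ tailSum a κ θ n (K n) ⁻¹' Set.Ici (1 / 8 * t)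
  have hBm : ∀ n, MeasurableSet (B n) := fun n =>
    (measurableSet_firstOne fun k _ => h.measurable_κ k).inter
      (measurable_tailSum a (h.measurable_θ n) (fun _ _ => h.measurable_κ _)
        (fun _ _ => h.measurable_θ _) measurableSet_Ici)
  have hBd : Pairwise (Function.onFun Disjoint B) := fun i j hij =>
    (disjoint_firstOne κ hij).mono Set.inter_subset_left Set.inter_subset_left
  calc ENNReal.ofReal (1 / 8) * tailBound α a 1 t
      = ∑' n, ENNReal.ofReal (1 - α) * ENNReal.ofReal (α ^ n) *
          (ENNReal.ofReal (1 / 8) * levelWeight α a 1 t n) := by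
        rw [tailBound_eq_tsum, ← ENNReal.tsum_mul_left]
        exact tsum_congr fun n => by ring
    _ ≤ ∑' n, μ (B n) := ENNReal.tsum_le_tsum fun n => by
        rw [h.measure_firstOne_inter hα0 a n (K n) measurableSet_Ici]
        gcongr
        exact hK n
    _ = μ (⋃ n, B n) := (measure_iUnion hBd hBm).symm
    _ ≤ _ := by
        refine measure_mono_ae ?_
        filter_upwards [h.ae_summable ha hsum, h.ae_nonneg_term ha] with ω hs h0 hω
        obtain ⟨n, hn, hge⟩ := Set.mem_iUnion.1 hω
        refine le_trans (Set.mem_Ici.1 hge) ?_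
        rw [← sum_range_eq_tailSum a hn]
        exact hs.sum_le_tsum _ fun k _ => h0 k

end IsBernoulliExpFamily

theorem mainTheorem5 :
    ∃ β γ₇ γ₈ γ₉ : ℝ, 1 ≤ β ∧ 0 < γ₇ ∧ 0 < γ₈ ∧ 0 < γ₉ ∧
      ∀ (Ω : Type*) [MeasurableSpace Ω] (μ : Measure Ω) [IsProbabilityMeasure μ]
        (α : ℝ) (κ θ : ℕ → Ω → ℝ) (a : ℕ → ℝ) (t : ℝ),
        0 ≤ α → α < 1 →
        (∀ n, Measurable (κ n)) → (∀ n, Measurable (θ n)) →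
        (∀ n, μ.real {ω | κ n ω = 0} = α) → (∀ n, μ.real {ω | κ n ω = 1} = 1 - α) →
        (∀ n, HasLaw (θ n) (expMeasure 1) μ) →
        iIndepFun (Sum.elim κ θ) μ →
        (∀ n, 0 ≤ a n) → Antitone a → Summable a →
        0 < t →
        (∀ᵐ ω ∂μ, Summable fun n => a n * κ n ω * θ n ω) ∧
        μ {ω | γ₇ * t ≤ ∑' n, a n * κ n ω * θ n ω} ≤ tailBound α a β t ∧
        ENNReal.ofReal γ₉ * tailBound α a β t ≤ μ {ω | γ₈ * t ≤ ∑' n, a n * κ n ω * θ n ω} := by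
  refine ⟨1, 5, 1 / 8, 1 / 8, le_rfl, by norm_num, by norm_num, by norm_num, ?_⟩
  intro Ω _ μ _ α κ θ a t hα0 hα hκm hθm hκ0 hκ1 hθ hind ha hanti hsum ht
  have h : IsBernoulliExpFamily μ α κ θ := ⟨hκm, hθm, hκ0, hκ1, hθ, hind⟩
  exact ⟨h.ae_summable ha hsum, h.measure_tsum_ge_le_tailBound hα0 hα ha hanti hsum ht,
    h.tailBound_le_measure_tsum_ge hα0 hα ha hanti hsum ht⟩
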